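/- Let $p$ be a prime and let $k,\ell$ be positive integers. For a pattern $\alpha=(a_1,\dots,a_k)\in\mathbb F_p^k$ and a nonnegative integer $n$, a family $\mathcal F\subseteq 2^{[n]}$ of subsets of $[n]=\{1,\dots,n\}$ is called $\alpha$-intersecting modulo $p$ if for every $i\in\{1,\dots,k\}$ and any $i$ distinct members $F_1,\dots,F_i\in\mathcal F$ one has $|F_1\cap\cdots\cap F_i|\equiv a_i \pmod p$. Let $f_\alpha(p,n)$ be the maximum size of a family $\mathcal F\subseteq 2^{[n]}$ that is $\alpha$-intersecting modulo $p$. For functions $f,g:\mathbb N\to[0,\infty)$ write $f=O(g)$ if there is a constant $C>0$ with $f(n)\le C\,g(n)$ for all sufficiently large $n$, and $f=\Omega(g)$ if $g=O(f)$; for fixed $\alpha$, $f_\alpha(p,n)$ is regarded as a function of $n$. Then the number of patterns $\alpha\in\mathbb F_p^k$ such that $$f_\alpha(p,n)=\Omega\bigl(n^{1/(p^\ell-1)}\bigr)$$ is at most $p^{2p^\ell-1}$, and every pattern $\alpha\in\mathbb F_p^k$ that does not have this property satisfies $$f_\alpha(p,n)=O\bigl(n^{1/p^\ell}\bigr).$$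 -/

import Mathlib

/-- A family `F` of subsets of an `n`-element set is `α`-intersecting modulo `p`, for a pattern
`α = (a₁, …, a_k)` over `ZMod p`, if for every `i ∈ {1, …, k}` the intersection of any `i` distinct
members of `F` has size congruent to `a_i` modulo `p`.  Here `a_i` is `α ⟨i - 1, _⟩`, and `i`
distinct members of `F` are a subfamily `S ⊆ F` with `i` elements. -/
def IsIntersectingMod (p : ℕ) {k n : ℕ} (α : Fin k → ZMod p) (F : Finset (Finset (Fin n))) : Prop :=
  ∀ i : Fin k, ∀ S : Finset (Finset (Fin n)), S ⊆ F → S.card = (i : ℕ) + 1 →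
    (((S.inf id : Finset (Fin n)).card : ℕ) : ZMod p) = α i

open Classical in
/-- The maximum size `f_α(p, n)` of a family of subsets of an `n`-element set that is
`α`-intersecting modulo `p`.  The empty family always qualifies. -/
noncomputable def maxIntersecting (p : ℕ) {k : ℕ} (α : Fin k → ZMod p) (n : ℕ) : ℕ :=
  (Finset.univ.filter
    (fun F : Finset (Finset (Fin n)) => IsIntersectingMod p α F)).sup Finset.card

/-- `f_α(p, n) = Ω(n ^ c)` as `n → ∞`. -/
def IsOmegaPow (p : ℕ) {k : ℕ} (α : Fin k → ZMod p) (c : ℝ) : Prop :=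
  (fun n : ℕ => (n : ℝ) ^ c) =O[Filter.atTop] (fun n : ℕ => (maxIntersecting p α n : ℝ))

/-- `f_α(p, n) = O(n ^ c)` as `n → ∞`. -/
def IsBigOPow (p : ℕ) {k : ℕ} (α : Fin k → ZMod p) (c : ℝ) : Prop :=
  (fun n : ℕ => (maxIntersecting p α n : ℝ)) =O[Filter.atTop] (fun n : ℕ => (n : ℝ) ^ c)

/-! Put `q = p ^ l`. The dichotomy is whether `a_i = a_{i+q}` for all `i ≥ q` with `i + q ≤ k`. If
`a_{q+c} ≠ a_{2q+c}` for some `c`, a large family yields `t ^ q` functions `u_a` on the ground set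
and partners `v_b` whose Gram matrix over `ZMod p` is a nonzero scalar matrix, so `t ^ q ≤ n`
(`IsIntersectingMod.pow_le`); hence the family has size `O(n ^ (1/q))`. If the pattern is periodic,
extend it to all indices and apply Möbius inversion on subsets of an `m`-set. Since `(1 - X) ^ q = 1
- X ^ q` in characteristic `p`, the weights vanish except on the bottom and top `q` levels
(`levelWeight_eq_zero`), so `m` sets fit on `O(m ^ (q-1))` points. As `1/q < 1/(q-1)`, the patterns
with the lower bound are exactly the periodic ones, and these are determined by `a_1, …, a_{2q-1}`.
-/

open Finset Polynomial

/-! ### Upper bound -/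

/-- The pattern `α`, indexed from `1` and extended by zero. -/
noncomputable def patternExt {p k : ℕ} (α : Fin k → ZMod p) (i : ℕ) : ZMod p :=
  if h : 1 ≤ i ∧ i ≤ k then α ⟨i - 1, by omega⟩ else 0

/-- `α` is periodic with period `q` from index `q` on. -/
def EventuallyPeriodic {p k : ℕ} (α : Fin k → ZMod p) (q : ℕ) : Prop :=
  ∀ i, q ≤ i → i + q ≤ k → patternExt α i = patternExt α (i + q)

lemma IsIntersectingMod.card_inter {p k n : ℕ} {α : Fin k → ZMod p} {F : Finset (Finset (Fin n))}
    (hF : IsIntersectingMod p α F) {ι : Type*} (e : ι → Finset (Fin n))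
    (he : Function.Injective e) (heF : ∀ i, e i ∈ F) (W : Finset ι) (h1 : 1 ≤ #W) (hk : #W ≤ k) :
    ∑ x, ∏ w ∈ W, (if x ∈ e w then (1 : ZMod p) else 0) = patternExt α #W := by
  classical
  have h := hF ⟨#W - 1, by omega⟩ (W.image e) (by
    intro s hs
    obtain ⟨i, -, rfl⟩ := Finset.mem_image.1 hs
    exact heF i) (by rw [Finset.card_image_of_injective _ he]; simp; omega)
  rw [patternExt, dif_pos ⟨h1, hk⟩, ← h]
  have : ((W.image e).inf id : Finset (Fin n)) = univ.filter fun x => ∀ w ∈ W, x ∈ e w := by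
    ext x
    simp [Finset.inf_image, Finset.mem_inf]
  rw [this, Finset.card_filter]
  push_cast
  refine Finset.sum_congr rfl fun x _ => ?_
  rw [Finset.prod_boole]

section Gram

variable {R : Type*} [CommRing R] {q t c : ℕ}

/-- Index set formed by one element `a j` and one element of `{b j, none}` in each of `q` blocks,
together with `c` fixed further elements. -/
def blockSet (c : ℕ) (a b : Fin q → Fin t) (J : Finset (Fin q)) :
    Finset ((Σ _ : Fin q, Option (Fin t)) ⊕ Fin c) :=
  (univ.sigma fun j => {some (a j), if j ∈ J then none else some (b j)}).disjSum univ

lemma card_blockSet (a b : Fin q → Fin t) (J : Finset (Fin q)) :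
    #(blockSet c a b J) = (∑ j, if j ∉ J ∧ a j = b j then 1 else 2) + c := by
  rw [blockSet, Finset.card_disjSum, Finset.card_sigma, Finset.card_univ, Fintype.card_fin]
  congr 1
  refine Finset.sum_congr rfl fun j _ => ?_
  by_cases hj : j ∈ J
  · simp [hj]
  · by_cases hab : a j = b j
    · simp [hj, hab]
    · simp [hj, hab]

lemma prod_blockSet {f : (Σ _ : Fin q, Option (Fin t)) ⊕ Fin c → R} (hf : ∀ i, f i * f i = f i)
    (a b : Fin q → Fin t) (J : Finset (Fin q)) :
    ∏ w ∈ blockSet c a b J, f w =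
      ((∏ i, f (.inr i)) * ∏ j, f (.inl ⟨j, some (a j)⟩)) *
        ((∏ j ∈ univ \ J, f (.inl ⟨j, some (b j)⟩)) * ∏ j ∈ J, f (.inl ⟨j, none⟩)) := by
  rw [blockSet, Finset.prod_disjSum, Finset.prod_sigma]
  have h : ∀ j ∈ (univ : Finset (Fin q)),
      ∏ o ∈ {some (a j), if j ∈ J then none else some (b j)}, f (.inl ⟨j, o⟩) =
      f (.inl ⟨j, some (a j)⟩) *
        if j ∈ J then f (.inl ⟨j, none⟩) else f (.inl ⟨j, some (b j)⟩) := by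
    intro j _
    by_cases hj : j ∈ J
    · simp [hj]
    · by_cases hab : a j = b j
      · simp [hj, hab, hf]
      · simp [hj, hab]
  rw [Finset.prod_congr rfl h, Finset.prod_mul_distrib, Finset.prod_ite, mul_comm _ (∏ i, _),
    ← mul_assoc, mul_comm (∏ j ∈ univ \ J, _)]
  have h2 : (univ.filter fun j => j ∉ J) = univ \ J := by ext; simp
  rw [h2, Finset.filter_mem_eq_inter, Finset.univ_inter]

/-- Expand the product of differences; `J` collects the blocks where the `none` term is chosen. -/
lemma gram_expand {X : Type*} [Fintype X]
    {χ : (Σ _ : Fin q, Option (Fin t)) ⊕ Fin c → X → R} (hχ : ∀ i x, χ i x * χ i x = χ i x)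
    (a b : Fin q → Fin t) :
    ∑ x, ((∏ i, χ (.inr i) x) * ∏ j, χ (.inl ⟨j, some (a j)⟩) x) *
        ∏ j, (χ (.inl ⟨j, some (b j)⟩) x - χ (.inl ⟨j, none⟩) x) =
      ∑ J : Finset (Fin q), (-1) ^ #J * ∑ x, ∏ w ∈ blockSet c a b J, χ w x := by
  simp_rw [Finset.mul_sum]
  rw [Finset.sum_comm]
  refine Finset.sum_congr rfl fun x _ => ?_
  rw [Finset.prod_sub, Finset.mul_sum, Finset.powerset_univ]
  refine Finset.sum_congr rfl fun J _ => ?_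
  rw [prod_blockSet (f := fun w => χ w x) (fun i => hχ i x)]
  ring

/-- In a block where `a` and `b` differ, two elements are used whether or not it lies in `J`.
Toggling it flips the sign and keeps the size. -/
lemma sum_sign_card_blockSet_of_ne (g : ℕ → R) {a b : Fin q → Fin t} (hab : a ≠ b) :
    ∑ J : Finset (Fin q), (-1) ^ #J * g #(blockSet c a b J) = 0 := by
  obtain ⟨j₀, hj₀⟩ := Function.ne_iff.1 hab
  have hcard : ∀ J, j₀ ∉ J → #(blockSet c a b (insert j₀ J)) = #(blockSet c a b J) := by
    intro J _
    rw [card_blockSet, card_blockSet]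
    congr 1
    refine Finset.sum_congr rfl fun j _ => ?_
    by_cases h : j = j₀
    · subst h; simp [hj₀]
    · simp [h]
  have hterm : ∀ J, j₀ ∉ J → (-1 : R) ^ #J * g #(blockSet c a b J) +
      (-1) ^ #(insert j₀ J) * g #(blockSet c a b (insert j₀ J)) = 0 := by
    intro J hJ
    rw [hcard J hJ, Finset.card_insert_of_notMem hJ]
    ring
  refine Finset.sum_involution (fun J _ => if j₀ ∈ J then J.erase j₀ else insert j₀ J) ?_ ?_ ?_ ?_
  · intro J _
    by_cases h : j₀ ∈ J
    · have := hterm (J.erase j₀) (by simp)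
      rw [Finset.insert_erase h] at this
      simp only [h, if_true]
      rw [add_comm]; exact this
    · simp only [h, if_false]
      exact hterm J h
  · intro J _ _ hJ
    by_cases h : j₀ ∈ J
    · simp only [h, if_true] at hJ
      exact absurd (hJ ▸ h) (by simp)
    · simp only [h, if_false] at hJ
      exact h (hJ ▸ Finset.mem_insert_self _ _)
  · intro J _; exact Finset.mem_univ _
  · intro J _
    by_cases h : j₀ ∈ J
    · simp [h]
    · simp [h]

/-- The size is now `p ^ l + #J + c`, and `p` divides every binomial coefficient of `p ^ l` except
the two extreme ones, leaving only `J = ∅` and `J = univ`. -/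
lemma sum_sign_card_blockSet_self {p l : ℕ} [Fact p.Prime] (g : ℕ → ZMod p)
    (a : Fin (p ^ l) → Fin t) :
    ∑ J : Finset (Fin (p ^ l)), (-1) ^ #J * g #(blockSet c a a J) =
      g (p ^ l + c) - g (2 * p ^ l + c) := by
  have hp : p.Prime := Fact.out
  have hcard : ∀ J : Finset (Fin (p ^ l)), #(blockSet c a a J) = p ^ l + #J + c := by
    intro J
    rw [card_blockSet]
    have : ∀ j ∈ (univ : Finset (Fin (p ^ l))),
        (if j ∉ J ∧ a j = a j then 1 else 2) = 1 + if j ∈ J then 1 else 0 := by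
      intro j _
      by_cases h : j ∈ J <;> simp [h]
    rw [Finset.sum_congr rfl this, Finset.sum_add_distrib]
    simp
  simp_rw [hcard]
  have := Finset.sum_powerset_apply_card (fun r => (-1) ^ r * g (p ^ l + r + c))
    (x := (univ : Finset (Fin (p ^ l))))
  rw [Finset.powerset_univ] at this
  rw [this, Finset.card_univ, Fintype.card_fin, Finset.sum_range_succ,
    Finset.sum_eq_single_of_mem 0 (by simp [hp.pos])]
  · have h1 : ((-1 : ZMod p)) ^ p ^ l = -1 := by
      simp
    rw [h1]
    simp [two_mul, sub_eq_add_neg]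
  · intro r hr hr0
    have : ((p ^ l).choose r : ZMod p) = 0 := by
      rw [ZMod.natCast_eq_zero_iff]
      exact hp.dvd_choose_pow hr0 (Finset.mem_range.1 hr).ne
    rw [nsmul_eq_mul, this, zero_mul]

end Gram

theorem IsIntersectingMod.pow_le {p k n l c t : ℕ} [Fact p.Prime] {α : Fin k → ZMod p}
    {F : Finset (Finset (Fin n))} (hF : IsIntersectingMod p α F) (hk : 2 * p ^ l + c ≤ k)
    (hne : patternExt α (p ^ l + c) ≠ patternExt α (2 * p ^ l + c))
    (hcard : p ^ l * (t + 1) + c ≤ #F) : t ^ p ^ l ≤ n := by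
  classical
  have hp : p.Prime := Fact.out
  obtain ⟨e⟩ : Nonempty (((Σ _ : Fin (p ^ l), Option (Fin t)) ⊕ Fin c) ↪ F) := by
    apply Function.Embedding.nonempty_of_card_le
    simpa using hcard
  let χ : ((Σ _ : Fin (p ^ l), Option (Fin t)) ⊕ Fin c) → Fin n → ZMod p :=
    fun w x => if x ∈ (e w : Finset (Fin n)) then 1 else 0
  let u : (Fin (p ^ l) → Fin t) → Fin n → ZMod p :=
    fun a x => (∏ i, χ (.inr i) x) * ∏ j, χ (.inl ⟨j, some (a j)⟩) x
  let v : (Fin (p ^ l) → Fin t) → Fin n → ZMod p :=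
    fun b x => ∏ j, (χ (.inl ⟨j, some (b j)⟩) x - χ (.inl ⟨j, none⟩) x)
  have hgram : ∀ a b, ∑ x, u a x * v b x = if a = b then
      patternExt α (p ^ l + c) - patternExt α (2 * p ^ l + c) else 0 := by
    intro a b
    have h1 : ∑ x, u a x * v b x =
        ∑ J : Finset (Fin (p ^ l)), (-1) ^ #J * patternExt α #(blockSet c a b J) := by
      rw [gram_expand (χ := χ) (fun i x => by simp [χ])]
      refine Finset.sum_congr rfl fun J _ => ?_
      congr 1
      have hlow : (∑ j : Fin (p ^ l), 1) ≤
          ∑ j, if j ∉ J ∧ a j = b j then 1 else 2 :=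
        Finset.sum_le_sum fun j _ => by split_ifs <;> simp
      have hhigh : (∑ j, if j ∉ J ∧ a j = b j then 1 else 2) ≤ ∑ j : Fin (p ^ l), 2 :=
        Finset.sum_le_sum fun j _ => by split_ifs <;> simp
      have hpos : 0 < p ^ l := pow_pos hp.pos l
      simp only [Finset.sum_const, Finset.card_univ, Fintype.card_fin, smul_eq_mul] at hlow hhigh
      exact hF.card_inter (fun w => (e w : Finset (Fin n)))
        (Subtype.val_injective.comp e.injective) (fun w => (e w).2) _
        (by rw [card_blockSet]; omega) (by rw [card_blockSet]; omega)
    rw [h1]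
    split_ifs with hab
    · subst hab
      exact sum_sign_card_blockSet_self _ _
    · exact sum_sign_card_blockSet_of_ne _ hab
  have hli : LinearIndependent (ZMod p) u := by
    rw [Fintype.linearIndependent_iff]
    intro lam hlam b
    have h0 : ∑ x, (∑ a, lam a • u a) x * v b x = 0 := by
      rw [hlam]; simp
    have h2 : ∑ x, (∑ a, lam a • u a) x * v b x = ∑ a, lam a * ∑ x, u a x * v b x := by
      simp_rw [Finset.mul_sum]
      rw [Finset.sum_comm]
      refine Finset.sum_congr rfl fun x _ => ?_
      simp [Finset.sum_apply, Finset.sum_mul, mul_assoc]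
    rw [h2] at h0
    simp only [hgram, mul_ite, mul_zero, Finset.sum_ite_eq', Finset.mem_univ, if_true] at h0
    exact (mul_eq_zero.1 h0).resolve_right (sub_ne_zero.2 hne)
  simpa using hli.fintype_card_le_finrank

lemma exists_family_card_eq_maxIntersecting (p : ℕ) {k : ℕ} (α : Fin k → ZMod p) (n : ℕ) :
    ∃ F : Finset (Finset (Fin n)), IsIntersectingMod p α F ∧ #F = maxIntersecting p α n := by
  classical
  have hne : (univ.filter fun F : Finset (Finset (Fin n)) => IsIntersectingMod p α F).Nonempty :=
    ⟨∅, by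
      simp only [Finset.mem_filter, Finset.mem_univ, true_and]
      intro i S hS hc
      rw [Finset.subset_empty.1 hS] at hc
      simp at hc⟩
  obtain ⟨F, hF, h⟩ := Finset.exists_mem_eq_sup _ hne Finset.card
  refine ⟨F, (Finset.mem_filter.1 hF).2, ?_⟩
  rw [maxIntersecting, ← h]

lemma IsIntersectingMod.card_le_maxIntersecting {p k n : ℕ} {α : Fin k → ZMod p}
    {F : Finset (Finset (Fin n))} (hF : IsIntersectingMod p α F) :
    #F ≤ maxIntersecting p α n :=
  Finset.le_sup (f := Finset.card) (by simpa using hF)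

theorem isBigOPow_of_not_eventuallyPeriodic {p k l : ℕ} [Fact p.Prime] {α : Fin k → ZMod p}
    (h : ¬ EventuallyPeriodic α (p ^ l)) : IsBigOPow p α (1 / (p : ℝ) ^ l) := by
  have hp : p.Prime := Fact.out
  simp only [EventuallyPeriodic, not_forall] at h
  obtain ⟨i, hi, hik, hne⟩ := h
  obtain ⟨c, rfl⟩ := Nat.exists_eq_add_of_le hi
  rw [show p ^ l + c + p ^ l = 2 * p ^ l + c by ring] at hne hik
  refine Asymptotics.IsBigO.of_bound (3 * (p : ℝ) ^ l + c) ?_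
  filter_upwards [Filter.eventually_ge_atTop 1] with n hn
  obtain ⟨F, hF, hFc⟩ := exists_family_card_eq_maxIntersecting p α n
  set r : ℝ := (n : ℝ) ^ (1 / (p : ℝ) ^ l) with hr
  have hq : (0 : ℝ) < (p : ℝ) ^ l := by have := hp.pos; positivity
  have hn1 : (1 : ℝ) ≤ n := by exact_mod_cast hn
  have hr1 : 1 ≤ r := Real.one_le_rpow hn1 (by positivity)
  have hrq : r ^ p ^ l = n := by
    rw [← Real.rpow_natCast, hr, ← Real.rpow_mul (by positivity)]
    push_cast
    rw [one_div, inv_mul_cancel₀ hq.ne', Real.rpow_one]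
  -- Take `t = ⌊r⌋₊ + 1` in `pow_le`: then `t > r`, so `t ^ p ^ l > n`.
  have hM : maxIntersecting p α n < p ^ l * (⌊r⌋₊ + 1 + 1) + c := by
    by_contra! hle
    have h1 := hF.pow_le hik hne (hFc ▸ hle)
    have h2 : r ^ p ^ l < ((⌊r⌋₊ + 1 : ℕ) : ℝ) ^ p ^ l := by
      refine pow_lt_pow_left₀ ?_ (by positivity) (pow_pos hp.pos l).ne'
      push_cast
      exact Nat.lt_floor_add_one r
    rw [hrq] at h2
    have h3 : n < (⌊r⌋₊ + 1) ^ p ^ l := by exact_mod_cast h2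
    omega
  have hM' : (maxIntersecting p α n : ℝ) ≤ (p : ℝ) ^ l * (⌊r⌋₊ + 1 + 1) + c := by
    exact_mod_cast hM.le
  have hfl : (⌊r⌋₊ : ℝ) ≤ r := Nat.floor_le (by positivity)
  rw [Real.norm_of_nonneg (by positivity), Real.norm_of_nonneg (by positivity)]
  calc (maxIntersecting p α n : ℝ) ≤ (p : ℝ) ^ l * (⌊r⌋₊ + 1 + 1) + c := hM'
    _ ≤ (p : ℝ) ^ l * (r + r + r) + c * r := by
      gcongr
      exact le_mul_of_one_le_right (by positivity) hr1
    _ = _ := by ring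

/-! ### Lower bound -/

/-- The shift operator on sequences. -/
def seqShift (R : Type*) [CommRing R] : (ℕ → R) →ₗ[R] (ℕ → R) where
  toFun g i := g (i + 1)
  map_add' _ _ := rfl
  map_smul' _ _ := rfl

section Shift

variable {R : Type*} [CommRing R]

lemma seqShift_pow_apply (r : ℕ) (g : ℕ → R) (i : ℕ) : (seqShift R ^ r) g i = g (i + r) := by
  induction r generalizing i with
  | zero => simp
  | succ r ih =>
    rw [pow_succ', Module.End.mul_apply]
    change (seqShift R ^ r) g (i + 1) = _
    rw [ih]
    congr 1
    ring

/-- The weights on levels of the subsets of an `m`-set whose sums over supersets are given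
by `g`. -/
noncomputable def levelWeight (m : ℕ) (g : ℕ → R) (t : ℕ) : R :=
  aeval (seqShift R) ((1 - X : R[X]) ^ (m - t)) g t

/-- Grouping supersets by size turns this into the binomial expansion of `(X + (1 - X)) ^ (m - #S) =
1`, evaluated at the shift operator. -/
lemma sum_levelWeight {m : ℕ} (g : ℕ → R) (S : Finset (Fin m)) :
    ∑ T ∈ univ.filter (S ⊆ ·), levelWeight m g #T = g #S := by
  have h1 : ∑ T ∈ univ.filter (S ⊆ ·), levelWeight m g #T =
      ∑ U ∈ Sᶜ.powerset, levelWeight m g (#S + #U) := by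
    symm
    refine Finset.sum_bij' (fun U _ => S ∪ U) (fun T _ => T \ S) ?_ ?_ ?_ ?_ ?_
    · intro U _; simp
    · intro T _
      rw [Finset.mem_powerset]
      intro x hx
      simp only [Finset.mem_sdiff] at hx
      simpa using hx.2
    · intro U hU
      have hd : Disjoint S U := by
        rw [Finset.mem_powerset] at hU
        exact (disjoint_compl_right (a := S)).mono_right hU
      exact Finset.union_sdiff_cancel_left hd
    · intro T hT
      exact Finset.union_sdiff_of_subset (Finset.mem_filter.1 hT).2
    · intro U hU
      have hd : Disjoint S U := by
        rw [Finset.mem_powerset] at hU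
        exact (disjoint_compl_right (a := S)).mono_right hU
      rw [Finset.card_union_of_disjoint hd]
  rw [h1, Finset.sum_powerset_apply_card (fun r => levelWeight m g (#S + r)), Finset.card_compl,
    Fintype.card_fin]
  have h2 : ∀ r, levelWeight m g (#S + r) =
      aeval (seqShift R) (X ^ r * (1 - X : R[X]) ^ (m - #S - r)) g #S := by
    intro r
    rw [map_mul, Module.End.mul_apply, map_pow (aeval (seqShift R)) X, aeval_X,
      seqShift_pow_apply, levelWeight, Nat.sub_sub]
  have h3 := congrArg (fun P : R[X] => aeval (seqShift R) P g #S)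
    (add_pow (X : R[X]) (1 - X) (m - #S))
  simp only [add_sub_cancel, one_pow, map_one, Module.End.one_apply, map_sum,
    LinearMap.sum_apply, Finset.sum_apply] at h3
  rw [h3]
  refine Finset.sum_congr rfl fun r _ => ?_
  rw [h2, ← nsmul_eq_mul', map_nsmul]
  rfl

lemma aeval_seqShift_eq_zero {q : ℕ} (P : R[X]) {f : ℕ → R} (hf : ∀ i, q ≤ i → f i = 0) (i : ℕ)
    (hi : q ≤ i) : aeval (seqShift R) P f i = 0 := by
  rw [aeval_eq_sum_range, LinearMap.sum_apply, Finset.sum_apply]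
  refine Finset.sum_eq_zero fun r _ => ?_
  rw [LinearMap.smul_apply, Pi.smul_apply, seqShift_pow_apply, hf _ (by omega), smul_zero]

end Shift

lemma levelWeight_eq_zero {p l m t : ℕ} [Fact p.Prime] {g : ℕ → ZMod p}
    (hg : ∀ i, p ^ l ≤ i → g (i + p ^ l) = g i) (ht : p ^ l ≤ t) (htm : t + p ^ l ≤ m) :
    levelWeight m g t = 0 := by
  have h : (1 - X : (ZMod p)[X]) ^ (m - t) =
      (1 - X) ^ (m - t - p ^ l) * (1 - X ^ p ^ l) := by
    have h1 : (1 - X : (ZMod p)[X]) ^ p ^ l = 1 - X ^ p ^ l := by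
      rw [sub_pow_char_pow, one_pow]
    rw [← h1, ← pow_add]
    congr 1
    omega
  rw [levelWeight, h, map_mul, Module.End.mul_apply]
  refine aeval_seqShift_eq_zero (q := p ^ l) _ ?_ t ht
  intro i hi
  rw [map_sub, map_one, map_pow, aeval_X, LinearMap.sub_apply, Pi.sub_apply, seqShift_pow_apply,
    hg i hi]
  simp

/-! ### Set families from weights on subsets -/

lemma exists_card_fiber {ι : Type*} [Fintype ι] [DecidableEq ι] (w : ι → ℕ) {n : ℕ}
    (h : ∑ i, w i ≤ n) :
    ∃ τ : Fin n → Option ι, ∀ i, #(univ.filter fun y => τ y = some i) = w i := by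
  classical
  obtain ⟨e⟩ : Nonempty ((Σ i, Fin (w i)) ↪ Fin n) := by
    apply Function.Embedding.nonempty_of_card_le
    simpa using h
  refine ⟨fun y => if h : ∃ x, e x = y then some h.choose.1 else none, fun i => ?_⟩
  have : (univ.filter fun y => (if h : ∃ x, e x = y then some h.choose.1 else none) = some i) =
      (univ : Finset (Fin (w i))).map ((Function.Embedding.sigmaMk i).trans e) := by
    ext y
    simp only [Finset.mem_filter, Finset.mem_univ, true_and, Finset.mem_map]
    constructor
    · intro hy
      split_ifs at hy with hx
      have h1 := hx.choose_spec
      generalize hx.choose = x at hy h1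
      obtain ⟨j, s⟩ := x
      simp only [Option.some.injEq] at hy
      subst hy
      exact ⟨s, h1⟩
    · rintro ⟨s, rfl⟩
      have hx : ∃ x, e x = ((Function.Embedding.sigmaMk i).trans e) s := ⟨_, rfl⟩
      rw [dif_pos hx]
      have h1 := e.injective hx.choose_spec
      rw [h1]
      rfl
  rw [this]
  simp

/-- Assign `w T` points to each `T`, and let the `j`-th set consist of the points whose `T` contains
`j`. Positive singleton weights make these sets distinct. -/
theorem le_maxIntersecting_of_weight {p k m n : ℕ} {α : Fin k → ZMod p}
    (w : Finset (Fin m) → ℕ) (hn : ∑ T, w T ≤ n) (hpos : ∀ j, 0 < w {j})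
    (hw : ∀ S : Finset (Fin m), ∀ i : Fin k, #S = i + 1 →
      ((∑ T ∈ univ.filter (S ⊆ ·), w T : ℕ) : ZMod p) = α i) :
    m ≤ maxIntersecting p α n := by
  classical
  obtain ⟨τ, hτ⟩ := exists_card_fiber w hn
  let G : Fin m → Finset (Fin n) := fun j => univ.filter fun y => ∃ T, τ y = some T ∧ j ∈ T
  have hG : Function.Injective G := by
    intro j j' hjj
    have h1 := hpos j
    rw [← hτ, Finset.card_pos] at h1
    obtain ⟨y, hy⟩ := h1
    have hy := (Finset.mem_filter.1 hy).2
    have : y ∈ G j := by simp [G, hy]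
    rw [hjj] at this
    obtain ⟨T, hT, hj'⟩ := (Finset.mem_filter.1 this).2
    rw [hy] at hT
    obtain rfl := Option.some.inj hT
    exact (Finset.mem_singleton.1 hj').symm
  have hF : IsIntersectingMod p α (univ.image G) := by
    intro i S hS hSc
    obtain ⟨A, -, rfl⟩ := Finset.subset_image_iff.1 hS
    rw [Finset.card_image_of_injective _ hG] at hSc
    rw [← hw A i hSc]
    congr 1
    have hA : A.Nonempty := by rw [← Finset.card_pos]; omega
    have h1 : ((A.image G).inf id : Finset (Fin n)) =
        (univ.filter (A ⊆ ·)).biUnion fun T => univ.filter fun y => τ y = some T := by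
      ext y
      simp only [Finset.inf_image, Finset.mem_inf, Function.comp, id, G, Finset.mem_biUnion,
        Finset.mem_filter, Finset.mem_univ, true_and]
      constructor
      · intro h
        obtain ⟨j, hj⟩ := hA
        obtain ⟨T, hT, -⟩ := h j hj
        refine ⟨T, fun j' hj' => ?_, hT⟩
        obtain ⟨T', hT', hm⟩ := h j' hj'
        rw [hT] at hT'
        exact Option.some.inj hT' ▸ hm
      · rintro ⟨T, hAT, hT⟩ j hj
        exact ⟨T, hT, hAT hj⟩
    rw [h1, Finset.card_biUnion]
    · exact Finset.sum_congr rfl fun T _ => hτ T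
    · intro T _ T' _ hne
      rw [Function.onFun, Finset.disjoint_left]
      intro y hy hy'
      rw [Finset.mem_filter] at hy hy'
      exact hne (Option.some.inj (hy.2.symm.trans hy'.2))
  have := hF.card_le_maxIntersecting
  rwa [Finset.card_image_of_injective _ hG, Finset.card_univ, Fintype.card_fin] at this

lemma card_filter_card_lt_le {m q : ℕ} (hm : 0 < m) :
    #(univ.filter fun T : Finset (Fin m) => #T < q) ≤ q * m ^ (q - 1) := by
  classical
  have h : (univ.filter fun T : Finset (Fin m) => #T < q) ⊆
      (Finset.range q).biUnion fun j => Finset.powersetCard j univ := by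
    intro T hT
    simpa using hT
  refine (Finset.card_le_card h).trans (Finset.card_biUnion_le.trans ?_)
  calc ∑ j ∈ Finset.range q, #(Finset.powersetCard j (univ : Finset (Fin m)))
      ≤ ∑ j ∈ Finset.range q, m ^ (q - 1) := by
        refine Finset.sum_le_sum fun j hj => ?_
        rw [Finset.card_powersetCard, Finset.card_univ, Fintype.card_fin]
        refine (Nat.choose_le_pow m j).trans (Nat.pow_le_pow_right hm ?_)
        have := Finset.mem_range.1 hj
        omega
    _ = q * m ^ (q - 1) := by simp

lemma card_filter_lt_card_add_le {m q : ℕ} (hm : 0 < m) :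
    #(univ.filter fun T : Finset (Fin m) => m < #T + q) ≤ q * m ^ (q - 1) := by
  classical
  refine le_trans ?_ (card_filter_card_lt_le hm)
  refine Finset.card_le_card_of_injOn compl ?_ compl_injective.injOn
  intro T hT
  have h1 : m < #T + q := by simpa using hT
  have h2 : #T ≤ m := by simpa using Finset.card_le_univ T
  have h3 : #Tᶜ < q := by
    rw [Finset.card_compl, Fintype.card_fin]; omega
  simpa using h3

theorem EventuallyPeriodic.le_maxIntersecting {p k l m n : ℕ} [Fact p.Prime] (hl : 0 < l)
    {α : Fin k → ZMod p} (h : EventuallyPeriodic α (p ^ l)) (hm : 0 < m)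
    (hn : 4 * p * p ^ l * m ^ (p ^ l - 1) ≤ n) : m ≤ maxIntersecting p α n := by
  classical
  have hp : p.Prime := Fact.out
  have hq : 1 < p ^ l := Nat.one_lt_pow hl.ne' hp.one_lt
  set q := p ^ l with hqdef
  let g : ℕ → ZMod p := fun i =>
    if i < q then patternExt α i else patternExt α (q + i % q)
  have hgper : ∀ i, q ≤ i → g (i + q) = g i := by
    intro i hi
    have h1 : ¬ i + q < q := by omega
    have h2 : ¬ i < q := by omega
    simp only [g, h1, h2, if_false, Nat.add_mod_right]
  have hpat : ∀ s r, r < q → q + r + s * q ≤ k →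
      patternExt α (q + r + s * q) = patternExt α (q + r) := by
    intro s r hr
    induction s with
    | zero => simp
    | succ s ih =>
      intro hk
      have e1 : q + r + (s + 1) * q = q + r + s * q + q := by ring
      rw [e1] at hk ⊢
      rw [← ih (by omega)]
      exact (h _ (by omega) hk).symm
  have hgeq : ∀ i, i ≤ k → g i = patternExt α i := by
    intro i hi
    by_cases hiq : i < q
    · simp [g, hiq]
    · simp only [g, hiq, if_false]
      obtain ⟨j, rfl⟩ := Nat.exists_eq_add_of_le (not_lt.1 hiq)
      have h1 : q + j % q + j / q * q = q + j := by
        have := Nat.mod_add_div' j q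
        omega
      have h2 := hpat (j / q) (j % q) (Nat.mod_lt _ (by omega)) (by omega)
      rw [h1] at h2
      rw [Nat.add_mod_left]
      exact h2.symm
  -- Adding `p` keeps the residue and makes singleton weights positive (singletons are on a low
  -- level because `1 < q`).
  let w : Finset (Fin m) → ℕ := fun T =>
    if #T < q ∨ m < #T + q then (levelWeight m g #T).val + p else 0
  have hwcast : ∀ T, (w T : ZMod p) = levelWeight m g #T := by
    intro T
    by_cases hT : #T < q ∨ m < #T + q
    · simp [w, hT]
    · have h0 : levelWeight m g #T = 0 :=
        levelWeight_eq_zero hgper (by omega) (by omega)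
      simp [w, hT, h0]
  refine le_maxIntersecting_of_weight w ?_ ?_ ?_
  · refine le_trans ?_ hn
    calc ∑ T, w T ≤ ∑ T ∈ (univ.filter fun T : Finset (Fin m) => #T < q ∨ m < #T + q), 2 * p := by
          rw [Finset.sum_filter]
          refine Finset.sum_le_sum fun T _ => ?_
          have := (ZMod.val_lt (levelWeight m g #T)).le
          simp only [w]
          split_ifs <;> omega
      _ ≤ (q * m ^ (q - 1) + q * m ^ (q - 1)) * (2 * p) := by
          rw [Finset.sum_const, smul_eq_mul, Finset.filter_or]
          gcongr
          exact (Finset.card_union_le _ _).trans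
            (add_le_add (card_filter_card_lt_le hm) (card_filter_lt_card_add_le hm))
      _ = 4 * p * q * m ^ (q - 1) := by ring
  · intro j
    have := hp.pos
    simp only [w, Finset.card_singleton, hq, true_or, if_true]
    omega
  · intro S i hS
    push_cast
    simp_rw [hwcast]
    rw [sum_levelWeight, hS, hgeq _ i.2, patternExt, dif_pos ⟨by omega, i.2⟩]
    rfl

theorem EventuallyPeriodic.isOmegaPow {p k l : ℕ} [Fact p.Prime] (hl : 0 < l)
    {α : Fin k → ZMod p} (h : EventuallyPeriodic α (p ^ l)) :
    IsOmegaPow p α (1 / ((p : ℝ) ^ l - 1)) := by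
  have hp : p.Prime := Fact.out
  have hq : 1 < p ^ l := Nat.one_lt_pow hl.ne' hp.one_lt
  have hqR : (0 : ℝ) < (p : ℝ) ^ l - 1 := by
    have : (1 : ℝ) < (p : ℝ) ^ l := by exact_mod_cast hq
    linarith
  set c : ℝ := 1 / ((p : ℝ) ^ l - 1) with hc
  set K : ℝ := 4 * p * (p : ℝ) ^ l with hK
  have hp0 : (0 : ℝ) < p := by exact_mod_cast hp.pos
  have hK0 : 0 < K := by positivity
  refine Asymptotics.IsBigO.of_bound (2 * K ^ c) ?_
  filter_upwards [Filter.eventually_ge_atTop ⌈K⌉₊] with n hn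
  have hnK : K ≤ n := Nat.ceil_le.1 hn
  set r : ℝ := (n / K : ℝ) ^ c with hr
  have hr1 : 1 ≤ r := Real.one_le_rpow ((one_le_div hK0).2 hnK) (by positivity)
  have hrq : r ^ (p ^ l - 1) = n / K := by
    rw [← Real.rpow_natCast, hr, ← Real.rpow_mul (by positivity)]
    rw [Nat.cast_sub hq.le]
    push_cast
    rw [hc, one_div, inv_mul_cancel₀ hqR.ne', Real.rpow_one]
  have hm : 0 < ⌊r⌋₊ := Nat.floor_pos.2 hr1
  have hle : ⌊r⌋₊ ≤ maxIntersecting p α n := by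
    refine h.le_maxIntersecting hl hm ?_
    have h1 : ((⌊r⌋₊ : ℕ) : ℝ) ^ (p ^ l - 1) ≤ n / K := by
      rw [← hrq]
      exact pow_le_pow_left₀ (by positivity) (Nat.floor_le (by positivity)) _
    rw [le_div_iff₀ hK0, mul_comm] at h1
    rw [hK] at h1
    exact_mod_cast h1
  have h2 : r ≤ 2 * maxIntersecting p α n := by
    have h3 := (Nat.lt_floor_add_one r).le
    have h4 : (1 : ℝ) ≤ ⌊r⌋₊ := by exact_mod_cast hm
    have h5 : (⌊r⌋₊ : ℝ) ≤ maxIntersecting p α n := by exact_mod_cast hle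
    linarith
  rw [Real.norm_of_nonneg (by positivity), Real.norm_of_nonneg (by positivity)]
  calc (n : ℝ) ^ c = K ^ c * r := by
        rw [hr, ← Real.mul_rpow hK0.le (by positivity), mul_div_cancel₀ _ hK0.ne']
    _ ≤ K ^ c * (2 * maxIntersecting p α n) := by gcongr
    _ = _ := by ring

/-! ### Counting patterns -/

lemma EventuallyPeriodic.ext {p k q : ℕ} (hq : 0 < q) {α β : Fin k → ZMod p}
    (hα : EventuallyPeriodic α q) (hβ : EventuallyPeriodic β q)
    (h : ∀ i, i < 2 * q → patternExt α i = patternExt β i) : α = β := by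
  have key : ∀ i, i ≤ k → patternExt α i = patternExt β i := by
    intro i
    induction i using Nat.strong_induction_on with
    | _ i ih =>
      intro hi
      by_cases hiq : i < 2 * q
      · exact h i hiq
      · have h1 := hα (i - q) (by omega) (by omega)
        have h2 := hβ (i - q) (by omega) (by omega)
        rw [Nat.sub_add_cancel (by omega)] at h1 h2
        rw [← h1, ← h2]
        exact ih _ (by omega) (by omega)
  funext i
  have := key (i + 1) i.2
  simpa [patternExt, Nat.succ_le_iff] using this

lemma ncard_eventuallyPeriodic_le (p k : ℕ) [NeZero p] {q : ℕ} (hq : 0 < q) :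
    {α : Fin k → ZMod p | EventuallyPeriodic α q}.ncard ≤ p ^ (2 * q - 1) := by
  have h := Set.ncard_le_ncard_of_injOn (s := {α : Fin k → ZMod p | EventuallyPeriodic α q})
    (t := Set.univ) (fun α (j : Fin (2 * q - 1)) => patternExt α (j + 1))
    (fun _ _ => Set.mem_univ _) (by
      intro α hα β hβ hab
      refine EventuallyPeriodic.ext hq hα hβ fun i hi => ?_
      -- Index `0` carries the default value `0`, so only `2 * q - 1` entries are free.
      rcases Nat.eq_zero_or_pos i with rfl | hi0
      · simp [patternExt]
      · have := congrFun hab ⟨i - 1, by omega⟩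
        simpa [Nat.sub_add_cancel hi0] using this)
  simpa [Set.ncard_univ, Nat.card_eq_fintype_card, ZMod.card] using h

lemma not_isOmegaPow_of_isBigOPow {p k : ℕ} {α : Fin k → ZMod p} {c d : ℝ} (hdc : d < c)
    (h : IsBigOPow p α d) : ¬ IsOmegaPow p α c := by
  intro h'
  have hlt : (fun x : ℝ => x ^ d) =o[Filter.atTop] fun x : ℝ => x ^ c := by
    refine Asymptotics.isLittleO_of_tendsto' ?_ ?_
    · filter_upwards [Filter.eventually_gt_atTop 0] with x hx h0
      exact absurd h0 (Real.rpow_pos_of_pos hx c).ne'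
    · refine (tendsto_rpow_neg_atTop (sub_pos.2 hdc)).congr' ?_
      filter_upwards [Filter.eventually_gt_atTop 0] with x hx
      rw [← Real.rpow_sub hx, neg_sub]
  refine (hlt.comp_tendsto tendsto_natCast_atTop_atTop).not_isBigO ?_ (h'.trans h)
  refine Filter.Eventually.frequently ?_
  filter_upwards [Filter.eventually_gt_atTop 0] with n hn
  exact (Real.rpow_pos_of_pos (Nat.cast_pos.2 hn) d).ne'

theorem mainTheorem6 (p : ℕ) (hp : p.Prime) (k ℓ : ℕ) (hk : 0 < k) (hℓ : 0 < ℓ) :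
    {α : Fin k → ZMod p | IsOmegaPow p α (1 / ((p : ℝ) ^ ℓ - 1))}.ncard ≤ p ^ (2 * p ^ ℓ - 1) ∧
    ∀ α : Fin k → ZMod p, ¬ IsOmegaPow p α (1 / ((p : ℝ) ^ ℓ - 1)) →
      IsBigOPow p α (1 / (p : ℝ) ^ ℓ) := by
  have : Fact p.Prime := ⟨hp⟩
  have hq : (1 : ℝ) < (p : ℝ) ^ ℓ := by exact_mod_cast Nat.one_lt_pow hℓ.ne' hp.one_lt
  refine ⟨le_trans (Set.ncard_le_ncard ?_ (Set.toFinite _))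
    (ncard_eventuallyPeriodic_le p k (pow_pos hp.pos ℓ)), fun α hα => ?_⟩
  · intro α hα
    by_contra hper
    exact not_isOmegaPow_of_isBigOPow (one_div_lt_one_div_of_lt (by linarith) (by linarith))
      (isBigOPow_of_not_eventuallyPeriodic hper) hα
  · exact isBigOPow_of_not_eventuallyPeriodic fun hper => hα (hper.isOmegaPow hℓ)
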